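/- For a compact metric space $(K,d)$ let $\mathrm{Lip}(K)$ be the algebra of all continuous functions $f:K\to\mathbb{C}$ with finite Lipschitz number $L(f)=\sup_{x\neq y}\frac{|f(x)-f(y)|}{d(x,y)}<\infty$. Put $\|f\|_\infty=\sup_{x\in K}|f(x)|$, $\|f\|_L=\|f\|_\infty+L(f)$ and $\|f\|_M=\max\{\|f\|_\infty,L(f)\}$, and let $\mathbf 1$ denote the constant function with value $1$. Let $K_1$ and $K_2$ be compact metric spaces. Suppose that $T:\mathrm{Lip}(K_1)\to\mathrm{Lip}(K_2)$ is a surjective complex-linear isometry with respect to the norm $\|\cdot\|_L$ and that $T\mathbf 1=\mathbf 1$. Then there exists a surjective isometry $\varphi:K_2\to K_1$ such that $$Tf(x)=f(\varphi(x)),\qquad f\in\mathrm{Lip}(K_1),\ x\in K_2.$$ Conversely, if $\varphi:K_2\to K_1$ is a surjective isometry, then $f\circ\varphi\in\mathrm{Lip}(K_2)$ for every $f\in\mathrm{Lip}(K_1)$, and the map $T:\mathrm{Lip}(K_1)\to\mathrm{Lip}(K_2)$, $Tf=f\circ\varphi$, is complex-linear, surjective, satisfies $T\mathbf 1=\mathbf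 1$, and is an isometry with respect to both $\|\cdot\|_L$ and $\|\cdot\|_M$. -/

import Mathlib

open scoped ENNReal NNReal

noncomputable section

/-- The Lipschitz number `L(F) = sup_{x ≠ y} |F x - F y| / d(x, y)`, with values in `[0, ∞]`. -/
def lipNumber {K : Type*} [MetricSpace K] (F : C(K, ℂ)) : ℝ≥0∞ :=
  ⨆ (x : K) (y : K) (_ : x ≠ y), ‖F x - F y‖ₑ / edist x y

theorem lipNumber_le_iff {K : Type*} [MetricSpace K] (F : C(K, ℂ)) (C : ℝ≥0) :
    lipNumber F ≤ C ↔ LipschitzWith C F := by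
  unfold lipNumber LipschitzWith
  simp only [iSup_le_iff]
  refine forall₂_congr fun x y => ?_
  rw [edist_eq_enorm_sub]
  by_cases h : x = y
  · simp [h]
  · have h0 : edist x y ≠ 0 := by simpa using h
    rw [ENNReal.div_le_iff h0 (edist_ne_top x y)]
    simp [h]

theorem lipNumber_lt_top_iff {K : Type*} [MetricSpace K] (F : C(K, ℂ)) :
    lipNumber F < ∞ ↔ ∃ C : ℝ≥0, LipschitzWith C F := by
  constructor
  · intro h
    refine ⟨(lipNumber F).toNNReal, (lipNumber_le_iff F _).1 ?_⟩
    rw [ENNReal.coe_toNNReal h.ne]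
  · rintro ⟨C, hC⟩
    exact ((lipNumber_le_iff F C).2 hC).trans_lt ENNReal.coe_lt_top

theorem lipNumber_mul_lt_top {K : Type*} [MetricSpace K] [CompactSpace K] {F G : C(K, ℂ)}
    (hF : lipNumber F < ∞) (hG : lipNumber G < ∞) : lipNumber (F * G) < ∞ := by
  rw [lipNumber_lt_top_iff] at *
  obtain ⟨A, hA⟩ := hF
  obtain ⟨B, hB⟩ := hG
  refine ⟨‖F‖₊ * B + A * ‖G‖₊, LipschitzWith.of_dist_le_mul fun x y => ?_⟩
  have h1 := hA.dist_le_mul x y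
  have h2 := hB.dist_le_mul x y
  rw [dist_eq_norm] at h1 h2
  have h3 : (F * G) x - (F * G) y = F x * (G x - G y) + (F x - F y) * G y := by
    simp only [ContinuousMap.mul_apply]; ring
  rw [dist_eq_norm, h3]
  calc ‖F x * (G x - G y) + (F x - F y) * G y‖
      ≤ ‖F x‖ * ‖G x - G y‖ + ‖F x - F y‖ * ‖G y‖ := by
        refine (norm_add_le _ _).trans ?_
        rw [norm_mul, norm_mul]
    _ ≤ ‖F‖ * (B * dist x y) + (A * dist x y) * ‖G‖ := by
        gcongr
        · exact F.norm_coe_le_norm x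
        · exact G.norm_coe_le_norm y
    _ = _ := by push_cast; ring

/-- `Lip(K)`: the unital algebra of the complex-valued continuous functions on the compact metric
space `K` whose Lipschitz number is finite. -/
def Lip (K : Type*) [MetricSpace K] [CompactSpace K] : Subalgebra ℂ C(K, ℂ) where
  carrier := {F | lipNumber F < ∞}
  mul_mem' hF hG := lipNumber_mul_lt_top hF hG
  add_mem' {F G} hF hG := by
    simp only [Set.mem_ofPred_eq, lipNumber_lt_top_iff] at *
    obtain ⟨A, hA⟩ := hF
    obtain ⟨B, hB⟩ := hG
    exact ⟨A + B, hA.add hB⟩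
  algebraMap_mem' c := by
    simp only [Set.mem_ofPred_eq, lipNumber_lt_top_iff]
    exact ⟨0, LipschitzWith.const c⟩

/-- The sum norm `‖f‖_L = ‖f‖_∞ + L(f)`. -/
def lipSumNorm {K : Type*} [MetricSpace K] [CompactSpace K] (f : Lip K) : ℝ :=
  ‖(f : C(K, ℂ))‖ + (lipNumber (f : C(K, ℂ))).toReal

/-- The max norm `‖f‖_M = max {‖f‖_∞, L(f)}`. -/
def lipMaxNorm {K : Type*} [MetricSpace K] [CompactSpace K] (f : Lip K) : ℝ :=
  max ‖(f : C(K, ℂ))‖ (lipNumber (f : C(K, ℂ))).toReal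

/-- `T` preserves the distances given by `N₁` on the source and by `N₂` on the target. -/
def IsIsometryFor {A B : Type*} [Sub A] [Sub B] (N₁ : A → ℝ) (N₂ : B → ℝ) (T : A → B) : Prop :=
  ∀ f g : A, N₂ (T f - T g) = N₁ (f - g)

end

/-! As t → ∞, ‖f + t‖_∞ = t + sup Re f + o(1), while L ignores constants; so a unital isometry
preserves sup Re f + L(f) (`supRe_add_lipConst_map`). The two summands are separated by rotating
functions whose range has a corner at a maximum of the real part (`lipConst_map_le_of_corner`);
every f becomes such a function after a small perturbation by a distance function
(`lipConst_map_le`). Applied also to the inverse, this shows that L and sup Re are each preserved.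
Testing sup Re on distance functions then turns point evaluations into point evaluations, which
gives φ. -/

section LipschitzAlgebra

variable {K : Type*} [MetricSpace K] [CompactSpace K]

/-- The Lipschitz number of an element of `Lip K`, as a real number. -/
noncomputable def lipConst (f : Lip K) : ℝ := (lipNumber (f : C(K, ℂ))).toReal

theorem lipSumNorm_eq (f : Lip K) : lipSumNorm f = ‖(f : C(K, ℂ))‖ + lipConst f := rfl

theorem lipConst_nonneg (f : Lip K) : 0 ≤ lipConst f := ENNReal.toReal_nonneg

theorem lipschitzWith_lipConst (f : Lip K) :
    LipschitzWith (lipNumber (f : C(K, ℂ))).toNNReal (f : C(K, ℂ)) := by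
  refine (lipNumber_le_iff _ _).1 ?_
  rw [ENNReal.coe_toNNReal (show lipNumber (f : C(K, ℂ)) < ∞ from f.2).ne]

theorem norm_sub_le_lipConst_mul (f : Lip K) (x y : K) :
    ‖(f : C(K, ℂ)) x - (f : C(K, ℂ)) y‖ ≤ lipConst f * dist x y := by
  rw [← dist_eq_norm]
  exact (lipschitzWith_lipConst f).dist_le_mul x y

theorem lipConst_le {f : Lip K} {C : ℝ} (hC : 0 ≤ C)
    (h : ∀ x y, ‖(f : C(K, ℂ)) x - (f : C(K, ℂ)) y‖ ≤ C * dist x y) : lipConst f ≤ C := by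
  lift C to ℝ≥0 using hC
  have h1 : lipNumber (f : C(K, ℂ)) ≤ C := by
    refine (lipNumber_le_iff _ _).2 (LipschitzWith.of_dist_le_mul fun x y => ?_)
    rw [dist_eq_norm]
    exact h x y
  exact ENNReal.toReal_le_coe_of_le_coe h1

theorem lipConst_add_le (f g : Lip K) : lipConst (f + g) ≤ lipConst f + lipConst g := by
  refine lipConst_le (add_nonneg (lipConst_nonneg f) (lipConst_nonneg g)) fun x y => ?_
  have h : ((f + g : Lip K) : C(K, ℂ)) x - ((f + g : Lip K) : C(K, ℂ)) y =
      ((f : C(K, ℂ)) x - (f : C(K, ℂ)) y) + ((g : C(K, ℂ)) x - (g : C(K, ℂ)) y) := by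
    simp only [Subalgebra.coe_add, ContinuousMap.add_apply]; ring
  rw [h, add_mul]
  exact (norm_add_le _ _).trans
    (add_le_add (norm_sub_le_lipConst_mul f x y) (norm_sub_le_lipConst_mul g x y))

theorem lipConst_smul_le (c : ℂ) (f : Lip K) : lipConst (c • f) ≤ ‖c‖ * lipConst f := by
  refine lipConst_le (mul_nonneg (norm_nonneg c) (lipConst_nonneg f)) fun x y => ?_
  have h : ((c • f : Lip K) : C(K, ℂ)) x - ((c • f : Lip K) : C(K, ℂ)) y =
      c * ((f : C(K, ℂ)) x - (f : C(K, ℂ)) y) := by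
    simp only [Subalgebra.coe_smul, ContinuousMap.smul_apply, smul_eq_mul]; ring
  rw [h, norm_mul, mul_assoc]
  exact mul_le_mul_of_nonneg_left (norm_sub_le_lipConst_mul f x y) (norm_nonneg c)

theorem lipConst_smul {c : ℂ} (hc : c ≠ 0) (f : Lip K) :
    lipConst (c • f) = ‖c‖ * lipConst f := by
  refine le_antisymm (lipConst_smul_le c f) ?_
  have h := lipConst_smul_le c⁻¹ (c • f)
  rw [inv_smul_smul₀ hc, norm_inv, ← div_eq_inv_mul, le_div_iff₀ (norm_pos_iff.2 hc)] at h
  linarith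

theorem lipConst_smul_one (c : ℂ) : lipConst (c • (1 : Lip K)) = 0 :=
  le_antisymm (lipConst_le le_rfl fun x y => by simp) (lipConst_nonneg _)

theorem lipConst_add_smul_one (f : Lip K) (c : ℂ) :
    lipConst (f + c • (1 : Lip K)) = lipConst f := by
  refine le_antisymm ?_ ?_
  · simpa [lipConst_smul_one] using lipConst_add_le f (c • (1 : Lip K))
  · have h := lipConst_add_le (f + c • (1 : Lip K)) ((-c) • (1 : Lip K))
    rwa [lipConst_smul_one, neg_smul, add_neg_cancel_right, add_zero] at h

theorem lipConst_le_lipSumNorm (f : Lip K) : lipConst f ≤ lipSumNorm f := by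
  rw [lipSumNorm_eq]
  linarith [norm_nonneg (f : C(K, ℂ))]

/-- The distance to a point, as an element of `Lip K`. -/
noncomputable def distLip (a : K) : Lip K :=
  ⟨⟨fun x => (dist x a : ℂ), by fun_prop⟩, by
    refine (lipNumber_lt_top_iff _).2 ⟨1, LipschitzWith.of_dist_le_mul fun x y => ?_⟩
    simpa [dist_eq_norm, ← Complex.ofReal_sub, Complex.norm_real] using
      abs_dist_sub_le x y a⟩

@[simp]
theorem distLip_apply (a x : K) : (distLip a : C(K, ℂ)) x = (dist x a : ℂ) := rfl

theorem lipConst_distLip_le (a : K) : lipConst (distLip a) ≤ 1 := by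
  refine lipConst_le zero_le_one fun x y => ?_
  simpa [← Complex.ofReal_sub, Complex.norm_real] using abs_dist_sub_le x y a

/-- The supremum of the real part of a function. -/
noncomputable def supRe (f : Lip K) : ℝ := ⨆ x, ((f : C(K, ℂ)) x).re

theorem re_le_supRe (f : Lip K) (x : K) : ((f : C(K, ℂ)) x).re ≤ supRe f := by
  refine le_ciSup (f := fun x => ((f : C(K, ℂ)) x).re) ⟨‖(f : C(K, ℂ))‖, ?_⟩ x
  rintro _ ⟨y, rfl⟩
  exact (Complex.re_le_norm _).trans ((f : C(K, ℂ)).norm_coe_le_norm y)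

theorem supRe_le [Nonempty K] {f : Lip K} {a : ℝ} (h : ∀ x, ((f : C(K, ℂ)) x).re ≤ a) :
    supRe f ≤ a := ciSup_le h

theorem exists_re_eq_supRe [Nonempty K] (f : Lip K) : ∃ x, ((f : C(K, ℂ)) x).re = supRe f := by
  obtain ⟨x, -, hx⟩ := isCompact_univ.exists_isMaxOn Set.univ_nonempty
    (Complex.continuous_re.comp (f : C(K, ℂ)).continuous).continuousOn
  exact ⟨x, le_antisymm (re_le_supRe f x) (supRe_le fun y => hx (Set.mem_univ y))⟩

theorem supRe_add_le_norm [Nonempty K] (f : Lip K) (t : ℝ) :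
    supRe f + t ≤ ‖((f + (t : ℂ) • (1 : Lip K) : Lip K) : C(K, ℂ))‖ := by
  obtain ⟨x, hx⟩ := exists_re_eq_supRe f
  rw [← hx]
  refine le_trans ?_ (ContinuousMap.norm_coe_le_norm _ x)
  refine le_trans (le_of_eq ?_) (Complex.re_le_norm _)
  simp

/-- For large t the imaginary part affects |z + t| only to second order, by at most (Im z)²/t. -/
theorem norm_add_smul_one_le (f : Lip K) {t : ℝ} (ht : 0 < t)
    (hft : 2 * ‖(f : C(K, ℂ))‖ ≤ t) :
    ‖((f + (t : ℂ) • (1 : Lip K) : Lip K) : C(K, ℂ))‖ ≤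
      supRe f + t + ‖(f : C(K, ℂ))‖ ^ 2 / t := by
  have key : ∀ x, ‖((f + (t : ℂ) • (1 : Lip K) : Lip K) : C(K, ℂ)) x‖ ≤
      supRe f + t + ‖(f : C(K, ℂ))‖ ^ 2 / t := by
    intro x
    have hn := (f : C(K, ℂ)).norm_coe_le_norm x
    have hM := re_le_supRe f x
    have hre := (abs_le.1 ((Complex.abs_re_le_norm _).trans hn)).1
    have him := (Complex.abs_im_le_norm _).trans hn
    have hval : ((f + (t : ℂ) • (1 : Lip K) : Lip K) : C(K, ℂ)) x = (f : C(K, ℂ)) x + t := by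
      simp
    rw [hval]
    generalize (f : C(K, ℂ)) x = z at *
    generalize ‖(f : C(K, ℂ))‖ = n at *
    have him2 : z.im ^ 2 ≤ n ^ 2 := sq_le_sq' (abs_le.1 him).1 (abs_le.1 him).2
    have hq : 0 ≤ n ^ 2 / t := by positivity
    have hqt : n ^ 2 / t * t = n ^ 2 := div_mul_cancel₀ _ ht.ne'
    have hstep : ‖z + t‖ ≤ z.re + t + n ^ 2 / t := by
      refine abs_le_of_sq_le_sq' ?_ (by linarith) |>.2
      rw [Complex.sq_norm, Complex.normSq_apply]
      simp only [Complex.add_re, Complex.ofReal_re, Complex.add_im, Complex.ofReal_im, add_zero]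
      nlinarith [mul_nonneg hq (show 0 ≤ 2 * z.re + t by linarith), sq_nonneg (n ^ 2 / t)]
    linarith
  -- On the empty space `supRe` takes the default value 0, so the bound survives.
  rcases isEmpty_or_nonempty K with hK | ⟨⟨x⟩⟩
  · have h0 : f = 0 := Subtype.ext (ContinuousMap.ext fun x => isEmptyElim x)
    rw [ContinuousMap.norm_le _ ]
    · exact key
    · simp [h0, supRe, ht.le]
  · exact (ContinuousMap.norm_le _ ((norm_nonneg _).trans (key x))).2 key

end LipschitzAlgebra

/-! ### Unital isometries for the sum norm. -/

section UnitalIsometry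

variable {K₁ K₂ : Type*} [MetricSpace K₁] [CompactSpace K₁] [MetricSpace K₂] [CompactSpace K₂]

/-- The norms of the translates `f + t • 1`, `t → ∞`, determine `supRe f + lipConst f`. -/
theorem supRe_add_lipConst_le [Nonempty K₂] {f : Lip K₁} {g : Lip K₂}
    (h : ∀ t : ℝ, lipSumNorm (g + (t : ℂ) • (1 : Lip K₂)) =
      lipSumNorm (f + (t : ℂ) • (1 : Lip K₁))) :
    supRe g + lipConst g ≤ supRe f + lipConst f := by
  refine le_of_forall_pos_le_add fun ε hε => ?_
  set n := ‖(f : C(K₁, ℂ))‖ with hn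
  have hn0 : 0 ≤ n := norm_nonneg _
  -- The terms serve the size condition, an error n²/t ≤ ε, and positivity.
  set t : ℝ := 2 * n + n ^ 2 / ε + 1 with ht
  have hq : 0 ≤ n ^ 2 / ε := by positivity
  have ht0 : 0 < t := by linarith
  have h1 := norm_add_smul_one_le f ht0 (by linarith)
  have h2 := supRe_add_le_norm g t
  have h3 := h t
  rw [lipSumNorm_eq, lipSumNorm_eq, lipConst_add_smul_one, lipConst_add_smul_one] at h3
  have h4 : n ^ 2 / t ≤ ε := by
    rw [div_le_iff₀ ht0]
    have : n ^ 2 / ε * ε = n ^ 2 := div_mul_cancel₀ _ hε.ne'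
    nlinarith
  linarith

variable {e : Lip K₁ ≃ₗ[ℂ] Lip K₂}

theorem supRe_add_lipConst_map [Nonempty K₁] [Nonempty K₂]
    (he : ∀ f, lipSumNorm (e f) = lipSumNorm f) (h1 : e 1 = 1) (f : Lip K₁) :
    supRe (e f) + lipConst (e f) = supRe f + lipConst f := by
  have h (t : ℝ) : lipSumNorm (e f + (t : ℂ) • (1 : Lip K₂)) =
      lipSumNorm (f + (t : ℂ) • (1 : Lip K₁)) := by
    rw [← he, map_add, map_smul, h1]
  exact le_antisymm (supRe_add_lipConst_le h) (supRe_add_lipConst_le fun t => (h t).symm)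

/-- If the range of `f` has a corner at `0`, then `e` does not increase the Lipschitz number. -/
theorem lipConst_map_le_of_corner [Nonempty K₁] [Nonempty K₂]
    (he : ∀ f, lipSumNorm (e f) = lipSumNorm f) (h1 : e 1 = 1) {f : Lip K₁} {a : K₁} {b : ℝ}
    (hb : 0 < b) (ha : (f : C(K₁, ℂ)) a = 0)
    (hf : ∀ x, ((f : C(K₁, ℂ)) x).re ≤ -(b * |((f : C(K₁, ℂ)) x).im|)) :
    lipConst (e f) ≤ lipConst f := by
  -- Multiplication by 1 + is turns the cone containing the range but keeps it in the left
  -- half-plane, with apex value 0 at a.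
  have hsup : ∀ s : ℝ, |s| ≤ b → supRe ((⟨1, s⟩ : ℂ) • f) = 0 := by
    intro s hs
    refine le_antisymm (supRe_le fun x => ?_) ?_
    · have h2 : -(s * ((f : C(K₁, ℂ)) x).im) ≤ b * |((f : C(K₁, ℂ)) x).im| := by
        refine (neg_le_abs _).trans ?_
        rw [abs_mul]
        exact mul_le_mul_of_nonneg_right hs (abs_nonneg _)
      have h3 := hf x
      simp only [Subalgebra.coe_smul, ContinuousMap.smul_apply, smul_eq_mul, Complex.mul_re]
      linarith
    · have h2 := re_le_supRe ((⟨1, s⟩ : ℂ) • f) a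
      simpa [ha] using h2
  have hmap : ∀ s : ℝ, |s| ≤ b → supRe ((⟨1, s⟩ : ℂ) • e f) =
      ‖(⟨1, s⟩ : ℂ)‖ * (lipConst f - lipConst (e f)) := by
    intro s hs
    have hc : (⟨1, s⟩ : ℂ) ≠ 0 := fun h => one_ne_zero (congrArg Complex.re h)
    have h2 := supRe_add_lipConst_map he h1 ((⟨1, s⟩ : ℂ) • f)
    rw [map_smul, lipConst_smul hc, lipConst_smul hc, hsup s hs] at h2
    linarith
  have hnorm : ‖(⟨1, -b⟩ : ℂ)‖ = ‖(⟨1, b⟩ : ℂ)‖ := by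
    exact Complex.norm_conj (⟨1, b⟩ : ℂ)
  have hlt : 1 < ‖(⟨1, b⟩ : ℂ)‖ := by
    have h2 := Complex.sq_norm (⟨1, b⟩ : ℂ)
    rw [Complex.normSq_apply] at h2
    simp only at h2
    nlinarith [norm_nonneg (⟨1, b⟩ : ℂ)]
  have h0 := hmap 0 (by simpa using hb.le)
  have hp := hmap b (abs_of_pos hb).le
  have hm := hmap (-b) (by rw [abs_neg, abs_of_pos hb])
  have hone : (⟨1, 0⟩ : ℂ) = 1 := rfl
  rw [hone, one_smul, norm_one, one_mul] at h0
  -- With D = L(f) - L(e f), the real part at y is D. Adding the bounds for 1 ± ib cancels the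
  -- imaginary part: D ≤ |1 + ib| D, and |1 + ib| > 1 forces D ≥ 0.
  obtain ⟨y, hy⟩ := exists_re_eq_supRe (e f)
  have hyp := re_le_supRe ((⟨1, b⟩ : ℂ) • e f) y
  have hym := re_le_supRe ((⟨1, -b⟩ : ℂ) • e f) y
  simp only [Subalgebra.coe_smul, ContinuousMap.smul_apply, smul_eq_mul, Complex.mul_re]
    at hyp hym
  rw [hp] at hyp
  rw [hm, hnorm] at hym
  nlinarith

/-- Subtracting ε d(·, a), with a a maximum point of Re f, creates a corner and changes both
Lipschitz numbers by O(ε). -/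
theorem lipConst_map_le [Nonempty K₁] [Nonempty K₂]
    (he : ∀ f, lipSumNorm (e f) = lipSumNorm f) (h1 : e 1 = 1) (f : Lip K₁) :
    lipConst (e f) ≤ lipConst f := by
  obtain ⟨a, ha⟩ := exists_re_eq_supRe f
  have hL := lipConst_nonneg f
  have hN : 0 ≤ lipSumNorm (distLip a) := (lipConst_nonneg _).trans (lipConst_le_lipSumNorm _)
  have key : ∀ ε : ℝ, 0 < ε →
      lipConst (e f) ≤ lipConst f + ε * (1 + lipSumNorm (distLip a)) := by
    intro ε hε
    set c := (f : C(K₁, ℂ)) a with hc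
    set g : Lip K₁ := f + (-(ε : ℂ)) • distLip a + (-c) • (1 : Lip K₁) with hg
    have hgx : ∀ x, (g : C(K₁, ℂ)) x = (f : C(K₁, ℂ)) x - c - ((ε * dist x a : ℝ) : ℂ) := by
      intro x
      simp [hg]
      ring
    have hcorner : lipConst (e g) ≤ lipConst g := by
      -- The slope works because |Im (f - c)| ≤ L(f) d(·, a); the 1 avoids division by zero.
      refine lipConst_map_le_of_corner he h1 (a := a) (b := ε / (lipConst f + 1))
        (by positivity) (by rw [hgx]; simp [hc]) fun x => ?_
      have h2 := re_le_supRe f x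
      have h3 := (Complex.abs_im_le_norm _).trans (norm_sub_le_lipConst_mul f x a)
      rw [← ha] at h2
      rw [hgx, Complex.sub_re, Complex.sub_im, Complex.ofReal_re, Complex.ofReal_im, sub_zero,
        Complex.sub_re]
      rw [← hc] at h3
      have hd : 0 ≤ dist x a := dist_nonneg
      have h4 : ε / (lipConst f + 1) * |((f : C(K₁, ℂ)) x - c).im| ≤ ε * dist x a := by
        rw [div_mul_eq_mul_div, div_le_iff₀ (by linarith), mul_assoc]
        refine mul_le_mul_of_nonneg_left ?_ hε.le
        linarith
      linarith
    have hεn : ‖(ε : ℂ)‖ = ε := by rw [Complex.norm_real, Real.norm_of_nonneg hε.le]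
    have hg1 : lipConst g ≤ lipConst f + ε := by
      rw [hg, lipConst_add_smul_one]
      refine (lipConst_add_le _ _).trans ?_
      have h2 := lipConst_smul_le (-(ε : ℂ)) (distLip a)
      rw [norm_neg, hεn] at h2
      nlinarith [lipConst_distLip_le a]
    have hef : e f = e g + (ε : ℂ) • e (distLip a) + c • (1 : Lip K₂) := by
      rw [hg, map_add, map_add, map_smul, map_smul, h1]
      module
    rw [hef, lipConst_add_smul_one]
    refine (lipConst_add_le _ _).trans ?_
    have h2 := lipConst_smul_le (ε : ℂ) (e (distLip a))
    have h3 := lipConst_le_lipSumNorm (e (distLip a))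
    rw [he] at h3
    rw [hεn] at h2
    nlinarith
  refine le_of_forall_pos_le_add fun δ hδ => ?_
  have h2 := key (δ / (1 + lipSumNorm (distLip a))) (by positivity)
  rwa [div_mul_cancel₀ _ (by positivity)] at h2

theorem lipSumNorm_symm_map (he : ∀ f, lipSumNorm (e f) = lipSumNorm f) (g : Lip K₂) :
    lipSumNorm (e.symm g) = lipSumNorm g := by
  rw [← he, e.apply_symm_apply]

theorem symm_map_one (h1 : e 1 = 1) : e.symm 1 = 1 := by
  rw [← h1, e.symm_apply_apply]

theorem lipConst_map [Nonempty K₁] [Nonempty K₂]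
    (he : ∀ f, lipSumNorm (e f) = lipSumNorm f) (h1 : e 1 = 1) (f : Lip K₁) :
    lipConst (e f) = lipConst f := by
  refine le_antisymm (lipConst_map_le he h1 f) ?_
  simpa using lipConst_map_le (lipSumNorm_symm_map he) (symm_map_one h1) (e f)

theorem supRe_map [Nonempty K₁] [Nonempty K₂]
    (he : ∀ f, lipSumNorm (e f) = lipSumNorm f) (h1 : e 1 = 1) (f : Lip K₁) :
    supRe (e f) = supRe f := by
  have h2 := supRe_add_lipConst_map he h1 f
  rw [lipConst_map he h1] at h2
  linarith

/-- The point x is where the image of -d(·, y) attains its maximal real part 0; since Re f ≤ Re f(y)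
+ L(f) d(·, y), preservation of sup Re bounds Re (e f)(x) by Re f(y). Using -f and i f gives
equality. -/
theorem exists_forall_map_apply_eq [Nonempty K₁] [Nonempty K₂]
    (he : ∀ f, lipSumNorm (e f) = lipSumNorm f) (h1 : e 1 = 1) (y : K₁) :
    ∃ x : K₂, ∀ f : Lip K₁, (e f : C(K₂, ℂ)) x = (f : C(K₁, ℂ)) y := by
  obtain ⟨x, hx⟩ := exists_re_eq_supRe (e (-distLip y))
  have hx0 : ((e (distLip y) : C(K₂, ℂ)) x).re = 0 := by
    have h2 : supRe (-distLip y) = 0 := by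
      refine le_antisymm (supRe_le fun z => by simp) ?_
      simpa using re_le_supRe (-distLip y) y
    rw [supRe_map he h1, h2, map_neg] at hx
    simpa using hx
  have hre : ∀ f : Lip K₁, ((e f : C(K₂, ℂ)) x).re ≤ ((f : C(K₁, ℂ)) y).re := by
    intro f
    set c := (f : C(K₁, ℂ)) y with hc
    set g : Lip K₁ := f + (-(lipConst f : ℂ)) • distLip y + (-c) • (1 : Lip K₁) with hg
    have hg0 : supRe g ≤ 0 := by
      refine supRe_le fun z => ?_
      have h2 := (Complex.re_le_norm _).trans (norm_sub_le_lipConst_mul f z y)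
      rw [← hc, Complex.sub_re] at h2
      simp [hg]
      linarith
    have h2 := (re_le_supRe (e g) x).trans ((supRe_map he h1 g).le.trans hg0)
    rw [hg, map_add, map_add, map_smul, map_smul, h1] at h2
    simp [hx0] at h2
    exact h2
  have hre_eq : ∀ f : Lip K₁, ((e f : C(K₂, ℂ)) x).re = ((f : C(K₁, ℂ)) y).re := by
    intro f
    refine le_antisymm (hre f) ?_
    have h2 := hre (-f)
    rw [map_neg] at h2
    simpa using h2
  refine ⟨x, fun f => Complex.ext (hre_eq f) ?_⟩
  have h2 := hre_eq (Complex.I • f)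
  rw [map_smul] at h2
  simpa using h2

theorem exists_isometry_of_lipSumNorm_map [Nonempty K₁] [Nonempty K₂]
    (he : ∀ f, lipSumNorm (e f) = lipSumNorm f) (h1 : e 1 = 1) :
    ∃ φ : K₂ → K₁, Isometry φ ∧ Function.Surjective φ ∧
      ∀ (f : Lip K₁) (x : K₂), (e f : C(K₂, ℂ)) x = (f : C(K₁, ℂ)) (φ x) := by
  have hs := lipSumNorm_symm_map he
  have hs1 := symm_map_one h1
  -- Applied to the inverse, so that φ goes from K₂ to K₁.
  choose φ hφ using exists_forall_map_apply_eq hs hs1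
  have hev (f : Lip K₁) (x : K₂) : (e f : C(K₂, ℂ)) x = (f : C(K₁, ℂ)) (φ x) := by
    simpa using (hφ x (e f)).symm
  refine ⟨φ, Isometry.of_dist_eq fun x y => le_antisymm ?_ ?_, fun y => ?_, hev⟩
  -- The 1-Lipschitz function d(·, φ y) keeps its Lipschitz number under e, so φ does not expand
  -- distances; the inverse gives the other inequality.
  · have h2 := norm_sub_le_lipConst_mul (e (distLip (φ y))) x y
    rw [lipConst_map he h1, hev, hev] at h2
    have h3 := mul_le_mul_of_nonneg_right (lipConst_distLip_le (φ y))
      (dist_nonneg (x := x) (y := y))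
    simp [Complex.norm_real] at h2
    linarith
  · have h2 := norm_sub_le_lipConst_mul (e.symm (distLip y)) (φ x) (φ y)
    rw [lipConst_map hs hs1, hφ, hφ] at h2
    have h3 := mul_le_mul_of_nonneg_right (lipConst_distLip_le y)
      (dist_nonneg (x := φ x) (y := φ y))
    simp [Complex.norm_real] at h2
    linarith
  · obtain ⟨x, hx⟩ := exists_forall_map_apply_eq he h1 y
    refine ⟨x, dist_le_zero.1 ?_⟩
    have h2 := hx (distLip y)
    rw [hev] at h2
    simp at h2
    simp [h2]

end UnitalIsometry

/-! ### Composition with a surjective isometry. -/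

section Composition

theorem lipNumber_eq_of_forall_apply_eq_comp {K₁ K₂ : Type*} [MetricSpace K₁]
    [MetricSpace K₂] {φ : K₂ → K₁} (hφ : Isometry φ) (hsurj : Function.Surjective φ)
    {F : C(K₁, ℂ)} {G : C(K₂, ℂ)} (h : ∀ x, G x = F (φ x)) :
    lipNumber G = lipNumber F := by
  unfold lipNumber
  rw [← hsurj.iSup_comp]
  refine iSup_congr fun x => ?_
  rw [← hsurj.iSup_comp]
  refine iSup_congr fun y => ?_
  rw [h, h, hφ.edist_eq, hφ.injective.ne_iff]

variable {K₁ K₂ : Type*} [MetricSpace K₁] [CompactSpace K₁] [MetricSpace K₂] [CompactSpace K₂]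

theorem norm_eq_of_forall_apply_eq_comp {φ : K₂ → K₁} (hsurj : Function.Surjective φ)
    {F : C(K₁, ℂ)} {G : C(K₂, ℂ)} (h : ∀ x, G x = F (φ x)) : ‖G‖ = ‖F‖ := by
  refine le_antisymm ((ContinuousMap.norm_le _ (norm_nonneg _)).2 fun x => ?_)
    ((ContinuousMap.norm_le _ (norm_nonneg _)).2 fun y => ?_)
  · rw [h]; exact F.norm_coe_le_norm _
  · obtain ⟨x, rfl⟩ := hsurj y
    rw [← h]; exact G.norm_coe_le_norm _

theorem isometryFor_of_forall_apply_eq_comp {φ : K₂ → K₁} (hφ : Isometry φ)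
    (hsurj : Function.Surjective φ) {T : Lip K₁ → Lip K₂}
    (hT : ∀ (f : Lip K₁) (x : K₂), (T f : C(K₂, ℂ)) x = (f : C(K₁, ℂ)) (φ x)) :
    IsIsometryFor lipSumNorm lipSumNorm T ∧ IsIsometryFor lipMaxNorm lipMaxNorm T := by
  have h (f g : Lip K₁) (x : K₂) :
      ((T f - T g : Lip K₂) : C(K₂, ℂ)) x = ((f - g : Lip K₁) : C(K₁, ℂ)) (φ x) := by
    simp [hT]
  constructor <;> intro f g
  · rw [lipSumNorm, lipSumNorm, norm_eq_of_forall_apply_eq_comp hsurj (h f g),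
      lipNumber_eq_of_forall_apply_eq_comp hφ hsurj (h f g)]
  · rw [lipMaxNorm, lipMaxNorm, norm_eq_of_forall_apply_eq_comp hsurj (h f g),
      lipNumber_eq_of_forall_apply_eq_comp hφ hsurj (h f g)]

theorem surjective_of_forall_apply_eq_comp {φ : K₂ → K₁} (hφ : Isometry φ)
    (hsurj : Function.Surjective φ) {T : Lip K₁ → Lip K₂}
    (hT : ∀ (f : Lip K₁) (x : K₂), (T f : C(K₂, ℂ)) x = (f : C(K₁, ℂ)) (φ x)) :
    Function.Surjective T := by
  intro g
  let ψ : K₂ ≃ᵢ K₁ := ⟨Equiv.ofBijective φ ⟨hφ.injective, hsurj⟩, hφ⟩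
  have hmem : (g : C(K₂, ℂ)).comp ⟨ψ.symm, ψ.symm.continuous⟩ ∈ Lip K₁ := by
    have h := lipNumber_eq_of_forall_apply_eq_comp ψ.symm.isometry ψ.symm.surjective
      (F := (g : C(K₂, ℂ))) (G := (g : C(K₂, ℂ)).comp ⟨ψ.symm, ψ.symm.continuous⟩) fun _ => rfl
    exact h.trans_lt g.2
  refine ⟨⟨_, hmem⟩, Subtype.ext (ContinuousMap.ext fun x => ?_)⟩
  rw [hT]
  exact congrArg (g : C(K₂, ℂ)) (ψ.symm_apply_apply x)

end Composition

theorem lip_one_eq_zero_iff {K : Type*} [MetricSpace K] [CompactSpace K] :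
    (1 : Lip K) = 0 ↔ IsEmpty K := by
  refine ⟨fun h => ⟨fun x => one_ne_zero (α := ℂ) ?_⟩, fun h => ?_⟩
  · exact congrArg (fun f : Lip K => (f : C(K, ℂ)) x) h
  · exact Subtype.ext (ContinuousMap.ext fun x => isEmptyElim x)

theorem corollary3p3 {K₁ K₂ : Type*} [MetricSpace K₁] [CompactSpace K₁]
    [MetricSpace K₂] [CompactSpace K₂] :
    (∀ T : Lip K₁ →ₗ[ℂ] Lip K₂,
      Function.Surjective T → IsIsometryFor lipSumNorm lipSumNorm T → T 1 = 1 →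
        ∃ φ : K₂ → K₁, Isometry φ ∧ Function.Surjective φ ∧
          ∀ (f : Lip K₁) (x : K₂), (T f : C(K₂, ℂ)) x = (f : C(K₁, ℂ)) (φ x)) ∧
    (∀ (φ : K₂ → K₁) (hφ : Isometry φ), Function.Surjective φ →
      (∀ f : Lip K₁, (f : C(K₁, ℂ)).comp ⟨φ, hφ.continuous⟩ ∈ Lip K₂) ∧
      ∀ T : Lip K₁ → Lip K₂,
        (∀ (f : Lip K₁) (x : K₂), (T f : C(K₂, ℂ)) x = (f : C(K₁, ℂ)) (φ x)) →
          IsLinearMap ℂ T ∧ Function.Surjective T ∧ T 1 = 1 ∧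
            IsIsometryFor lipSumNorm lipSumNorm T ∧ IsIsometryFor lipMaxNorm lipMaxNorm T) := by
  refine ⟨fun T hsurj hT h1 => ?_, fun φ hφ hsurj => ⟨fun f => ?_, fun T hT => ?_⟩⟩
  · have hN (f : Lip K₁) : lipSumNorm (T f) = lipSumNorm f := by simpa using hT f 0
    have hinj : Function.Injective T := by
      refine (injective_iff_map_eq_zero T).2 fun f hf => ?_
      have h2 := hN f
      have h3 : lipSumNorm (0 : Lip K₂) = 0 := by
        rw [lipSumNorm_eq, ← zero_smul ℂ (1 : Lip K₂), lipConst_smul_one]; simp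
      rw [hf, h3, lipSumNorm_eq] at h2
      have h4 : ‖(f : C(K₁, ℂ))‖ = 0 :=
        le_antisymm (by linarith [lipConst_nonneg f]) (norm_nonneg _)
      exact Subtype.ext (norm_eq_zero.1 h4)
    -- The extremal arguments need points; emptiness is visible algebraically as 1 = 0, so it passes
    -- through T.
    have hiff : IsEmpty K₁ ↔ IsEmpty K₂ := by
      rw [← lip_one_eq_zero_iff, ← lip_one_eq_zero_iff, ← h1, map_eq_zero_iff T hinj]
    rcases isEmpty_or_nonempty K₂ with hK₂ | hK₂
    · have hK₁ := hiff.2 hK₂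
      exact ⟨fun x => isEmptyElim x, fun x => isEmptyElim x, fun y => isEmptyElim y,
        fun _ x => isEmptyElim x⟩
    · have hK₁ : Nonempty K₁ := by
        rw [← not_isEmpty_iff, hiff, not_isEmpty_iff]; exact hK₂
      exact exists_isometry_of_lipSumNorm_map (e := LinearEquiv.ofBijective T ⟨hinj, hsurj⟩) hN h1
  · exact (lipNumber_eq_of_forall_apply_eq_comp hφ hsurj fun _ => rfl).trans_lt f.2
  · refine ⟨⟨fun f g => ?_, fun c f => ?_⟩, surjective_of_forall_apply_eq_comp hφ hsurj hT, ?_,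
      isometryFor_of_forall_apply_eq_comp hφ hsurj hT⟩
    all_goals
      refine Subtype.ext (ContinuousMap.ext fun x => ?_)
      simp [hT]
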